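/- Let $T$ be a complete first-order theory. By a set $A$ of $T$ we mean a subset of the universe of a model of $T$ (equivalently, of a fixed big saturated model of $T$). The algebraic closure $\mathrm{acl}(A)$ is the union of the solution sets of those formulas $\varphi(x,\overline{a})$, with $x$ a single variable and parameters $\overline{a}\in A$, that have finitely many solutions, and the definable closure $\mathrm{dcl}(A)$ is the union of the solution sets of those formulas $\varphi(x,\overline{a})$, $\overline{a}\in A$, that have exactly one solution. The acl-dcl-difference $\mathrm{acl}\text{-}\mathrm{dcl}_{\mathrm{dif}}(T)$ is the least $n\in\omega$ such that $\mathrm{dcl}(A)=\mathrm{acl}(A)$ for every set $A$ of $T$ with $|A|\geq n$; if no such $n$ exists, it is $\infty$. Theorem. For every $\lambda\in\omega\cup\{\infty\}$ there is a complete first-order theory $T_\lambda$ with $\mathrm{acl}\text{-}\mathrm{dcl}_{\mathrm{dif}}(T_\lambda)=\lambda$. -/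

import Mathlib

namespace ModelClosure

universe u v w

/-- The algebraic closure `acl(A)` in the `L`-structure `M`: the union of the finite solution sets
of formulas in one free variable with parameters from `A`. -/
def acl (L : FirstOrder.Language.{u, v}) {M : Type w} [L.Structure M] (A : Set M) : Set M :=
  {b | ∃ S : Set M, A.Definable₁ L S ∧ S.Finite ∧ b ∈ S}

/-- The definable closure `dcl(A)` in the `L`-structure `M`: the set of unique solutions of
formulas in one free variable with parameters from `A`. -/
def dcl (L : FirstOrder.Language.{u, v}) {M : Type w} [L.Structure M] (A : Set M) : Set M :=
  {b | A.Definable₁ L {b}}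

/-- `dcl(A) = acl(A)` for every set `A` of `T` with at least `n` elements. Here a set of `T` is a
subset of any model of `T`. For complete `T` this agrees with taking the subsets of one big
saturated model, because both closures are unchanged under elementary extensions. -/
def ClosuresAgreeFrom {L : FirstOrder.Language.{u, v}} (T : L.Theory) (n : ℕ) : Prop :=
  ∀ (M : FirstOrder.Language.Theory.ModelType.{u, v, max u v} T) (A : Set M), (n : ℕ∞) ≤ A.encard → dcl L A = acl L A

/-- The acl-dcl-difference of `T`: the least natural number `n` such that `dcl(A) = acl(A)` for
every set `A` of `T` with `|A| ≥ n`, and `∞` (that is, `⊤`) if there is no such `n`. -/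
noncomputable def aclDclDif {L : FirstOrder.Language.{u, v}} (T : L.Theory) : ℕ∞ :=
  sInf {k : ℕ∞ | ∃ n : ℕ, k = n ∧ ClosuresAgreeFrom T n}

end ModelClosure

namespace ModelClosure

open FirstOrder FirstOrder.Language

/-! ### Closures and automorphisms -/

section Closures

variable {L : FirstOrder.Language} {M : Type*} [L.Structure M] {A : Set M}

/-! For finite λ = n, take n + 1 core points and infinitely many names of each permutation of them;
operation i fixes core points and evaluates names at i. Swapping two names of one permutation shows
that acl(A) is A plus the core (`acl_subset`). One name defines every core point, and n core points
define the last one, so the closures agree once |A| ≥ n (`core_subset_dcl`). Over n - 1 core points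
the other two are exchanged by an automorphism. `EnumeratesCore` isolates the first-order properties
used for agreement, so it passes to all models (`of_completeTheory`). For λ = ∞, two core points
beside an infinite ray are exchanged by an automorphism fixing the ray. -/

theorem dcl_subset_acl : dcl L A ⊆ acl L A :=
  fun b hb => ⟨{b}, hb, Set.finite_singleton b, rfl⟩

/-- Membership in an `A`-definable set is invariant under automorphisms fixing `A` pointwise. -/
theorem mem_iff_of_definable₁ {S : Set M} (hS : A.Definable₁ L S) (e : M ≃[L] M)
    (he : ∀ a ∈ A, e a = a) (x : M) : e x ∈ S ↔ x ∈ S := by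
  obtain ⟨φ, hφ⟩ := Set.definable_iff_exists_formula_sum.1 hS
  have key : ∀ y : M, y ∈ S ↔ φ.Realize (Sum.elim (fun a : A => (a : M)) fun _ : Fin 1 => y) :=
    fun y => Set.ext_iff.1 hφ fun _ => y
  rw [key, key, ← StrongHomClass.realize_formula e φ
    (v := Sum.elim (fun a : A => (a : M)) fun _ => x)]
  refine iff_of_eq (congrArg φ.Realize (funext ?_))
  rintro (a | a)
  · exact (he a a.2).symm
  · rfl

theorem apply_eq_of_mem_dcl {b : M} (hb : b ∈ dcl L A) (e : M ≃[L] M)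
    (he : ∀ a ∈ A, e a = a) : e b = b :=
  (mem_iff_of_definable₁ hb e he b).2 rfl

theorem definable₁_singleton_of_mem {a : M} (ha : a ∈ A) : A.Definable₁ L {a} :=
  Set.Definable.singleton_of_mem L ha

theorem definable₁_of_finite_subset {S : Set M} (hS : S.Finite) (hSA : S ⊆ A) :
    A.Definable₁ L S := by
  have := hS.to_subtype
  have h := Set.definable_iUnion_of_finite (L := L) (A := A)
    fun s : S => definable₁_singleton_of_mem (hSA s.2)
  refine (congrArg (A.Definable L) ?_).mp h
  ext x
  constructor
  · intro hx
    obtain ⟨s, hs⟩ := Set.mem_iUnion.1 hx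
    have : x 0 = s := hs
    exact (this ▸ s.2 : x 0 ∈ S)
  · intro hx
    exact Set.mem_iUnion.2 ⟨⟨x 0, hx⟩, rfl⟩

/-- To refute membership in `acl A`, it suffices to move the point by automorphisms over each
finite subset of `A` outside each finite set. -/
theorem notMem_acl {b : M} (h : ∀ A₀ S : Set M, A₀.Finite → A₀ ⊆ A → S.Finite →
    ∃ e : M ≃[L] M, (∀ a ∈ A₀, e a = a) ∧ e b ∉ S) : b ∉ acl L A := by
  rintro ⟨S, hS, hfin, hb⟩
  obtain ⟨A₀, hA₀, hdef⟩ := Set.definable_iff_finitely_definable.1 hS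
  obtain ⟨e, he, hS'⟩ := h A₀ S A₀.finite_toSet hA₀ hfin
  exact hS' ((mem_iff_of_definable₁ hdef e he b).2 hb)

end Closures

/-! ### Bounding the difference; transfer between models -/

section Theories

variable {L : FirstOrder.Language} {T : L.Theory}

theorem ClosuresAgreeFrom.aclDclDif_eq {n : ℕ} (h : ClosuresAgreeFrom T n)
    (h' : ∀ m < n, ¬ ClosuresAgreeFrom T m) : aclDclDif T = n := by
  refine le_antisymm (sInf_le ⟨n, rfl, h⟩) (le_sInf ?_)
  rintro _ ⟨m, rfl, hm⟩
  exact Nat.cast_le.2 (not_lt.1 fun hlt => h' m hlt hm)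

theorem aclDclDif_eq_top (h : ∀ m, ¬ ClosuresAgreeFrom T m) : aclDclDif T = ⊤ := by
  refine top_unique (le_sInf ?_)
  rintro _ ⟨m, rfl, hm⟩
  exact (h m hm).elim

theorem not_closuresAgreeFrom {L : FirstOrder.Language.{0, 0}} {T : L.Theory} (M : Type) [L.Structure M]
    [M ⊨ T] {A : Set M} {m : ℕ} (hA : (m : ℕ∞) ≤ A.encard) {b : M} (hb : b ∈ acl L A) (e : M ≃[L] M)
    (he : ∀ a ∈ A, e a = a) (heb : e b ≠ b) : ¬ ClosuresAgreeFrom T m := by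
  intro h
  have : Nonempty M := ⟨b⟩
  have h' : dcl L A = acl L A := h (Theory.ModelType.of T M) A hA
  exact heb (apply_eq_of_mem_dcl (h' ▸ hb) e he)

/-- A universally valid formula stays universally valid in models of the complete theory. -/
theorem realize_of_completeTheory {M N V : Type*} [L.Structure M] [L.Structure N]
    [N ⊨ L.completeTheory M] [Finite V] (φ : L.Formula V)
    (h : ∀ v : V → M, φ.Realize v) (v : V → N) : φ.Realize v := by
  have hN := (realize_iff_of_model_completeTheory M N
    (Formula.iAlls V (φ.relabel (Sum.inr : V → Empty ⊕ V)))).2 (by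
      simp only [Sentence.Realize, Formula.realize_iAlls, Formula.realize_relabel]
      exact h)
  simp only [Sentence.Realize, Formula.realize_iAlls, Formula.realize_relabel] at hN
  exact hN v

end Theories

/-! ### Unary operations and their common fixed points -/

/-- The function symbols of the language of `ι`-indexed families of unary operations. -/
inductive UnaryFunctions (ι : Type) : ℕ → Type
  | app : ι → UnaryFunctions ι 1

/-- The language of `ι`-indexed families of unary operations. -/
def unaryLanguage (ι : Type) : FirstOrder.Language.{0, 0} :=
  ⟨UnaryFunctions ι, fun _ => Empty⟩

/-- The structure given by a family of unary operations. -/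
@[reducible] def unaryStructure {ι M : Type} (f : ι → M → M) : (unaryLanguage ι).Structure M where
  funMap := fun {_} g x => match g with
    | UnaryFunctions.app i => f i (x 0)
  RelMap := fun r _ => r.elim

section Unary

variable {ι M : Type} [(unaryLanguage ι).Structure M]

/-- The operation named by `i`. -/
def op (i : ι) (x : M) : M :=
  Structure.funMap (L := unaryLanguage ι) (UnaryFunctions.app i) ![x]

/-- The term applying the operation named by `i` to a term. -/
def opTerm {V : Type} (i : ι) (t : (unaryLanguage ι).Term V) : (unaryLanguage ι).Term V :=
  Term.func (UnaryFunctions.app i) ![t]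

@[simp]
theorem realize_opTerm {V : Type} (i : ι) (t : (unaryLanguage ι).Term V) (v : V → M) :
    (opTerm i t).realize v = op i (t.realize v) := by
  simp only [opTerm, Term.realize, op]
  congr 1
  funext j
  fin_cases j
  rfl

/-- A permutation commuting with the operations is an automorphism. -/
def equivOfCommute (e : M ≃ M) (he : ∀ (i : ι) (x : M), e (op i x) = op i (e x)) :
    M ≃[unaryLanguage ι] M where
  toEquiv := e
  map_fun' := by
    rintro _ ⟨i⟩ x
    have hx : x = ![x 0] := by
      funext j
      fin_cases j
      rfl
    have h : e ∘ x = ![e (x 0)] := by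
      funext j
      fin_cases j
      rfl
    have := he i (x 0)
    simp only [op, ← hx, ← h] at this
    exact this
  map_rel' := fun r _ => r.elim

@[simp]
theorem equivOfCommute_apply (e : M ≃ M) (he : ∀ (i : ι) (x : M), e (op i x) = op i (e x))
    (x : M) : equivOfCommute e he x = e x :=
  rfl

variable (ι M) in
/-- The points fixed by all operations. -/
def core : Set M :=
  {x | ∀ i : ι, op i x = x}

/-- The formula asserting that a term takes its value in the core. -/
noncomputable def coreFormula {V : Type} [Finite ι] (t : (unaryLanguage ι).Term V) :
    (unaryLanguage ι).Formula V :=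
  Formula.iInf fun i : ι => (opTerm i t).equal t

@[simp]
theorem realize_coreFormula [Finite ι] {V : Type} (t : (unaryLanguage ι).Term V) (v : V → M) :
    (coreFormula t).Realize v ↔ t.realize v ∈ core ι M := by
  simp [coreFormula, core]

theorem definable₁_core [Finite ι] (A : Set M) : A.Definable₁ (unaryLanguage ι) (core ι M) := by
  refine Set.definable_iff_exists_formula_sum.2 ⟨coreFormula (Term.var (Sum.inr 0)), ?_⟩
  ext v
  simp only [Set.mem_ofPred_eq, realize_coreFormula]
  rfl

theorem op_mem_dcl {A : Set M} {x : M} (hx : x ∈ A) (i : ι) :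
    op i x ∈ dcl (unaryLanguage ι) A := by
  refine Set.definable_iff_exists_formula_sum.2
    ⟨(Term.var (Sum.inr 0)).equal (opTerm i (Term.var (Sum.inl ⟨x, hx⟩))), ?_⟩
  ext v
  simp only [Set.mem_ofPred_eq, Formula.realize_equal, realize_opTerm, Term.realize_var,
    Sum.elim_inl, Sum.elim_inr]
  rfl

theorem core_subset_acl [Finite ι] (A : Set M) (h : (core ι M).Finite) :
    core ι M ⊆ acl (unaryLanguage ι) A :=
  fun _ hb => ⟨_, definable₁_core A, h, hb⟩

variable (ι M) in
/-- All operations map into the core, each point outside the core enumerates the core through the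
operations, and each such enumeration comes from infinitely many points if from any. -/
structure EnumeratesCore : Prop where
  op_mem_core (i : ι) (x : M) : op i x ∈ core ι M
  exists_op_eq (x y : M) (hx : x ∉ core ι M) (hy : y ∈ core ι M) : ∃ i : ι, op i x = y
  exists_notMem_core : ∃ x, x ∉ core ι M
  infinite_fiber (x : M) (hx : x ∉ core ι M) :
    {z | z ∉ core ι M ∧ ∀ i : ι, op i z = op i x}.Infinite

namespace EnumeratesCore

theorem encard_core_le [Finite ι] (h : EnumeratesCore ι M) :
    (core ι M).encard ≤ Nat.card ι := by
  obtain ⟨x, hx⟩ := h.exists_notMem_core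
  calc (core ι M).encard ≤ ((fun i : ι => op i x) '' Set.univ).encard :=
        Set.encard_le_encard fun y hy =>
          let ⟨i, hi⟩ := h.exists_op_eq x y hx hy
          ⟨i, trivial, hi⟩
    _ ≤ (Set.univ : Set ι).encard := Set.encard_image_le _ _
    _ = Nat.card ι := by rw [Set.encard_univ, ENat.card_eq_coe_natCard]

/-- A point of `A` outside the core yields all core points by applying operations. Otherwise `A`
lies in the core and, by counting, misses at most one point of it. -/
theorem core_subset_dcl [Finite ι] (h : EnumeratesCore ι M) {n : ℕ} (hn : Nat.card ι ≤ n + 1)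
    {A : Set M} (hA : (n : ℕ∞) ≤ A.encard) : core ι M ⊆ dcl (unaryLanguage ι) A := by
  intro c hc
  by_cases hcA : c ∈ A
  · exact definable₁_singleton_of_mem hcA
  by_cases hout : A ⊆ core ι M
  · have hsub : A ⊆ core ι M \ {c} := fun a ha => ⟨hout ha, fun hac => hcA (hac ▸ ha)⟩
    have hcard : (core ι M \ {c}).encard ≤ n := by
      have h1 := (Set.encard_sdiff_singleton_add_one hc).le.trans h.encard_core_le
      have h2 : (Nat.card ι : ℕ∞) ≤ (n : ℕ∞) + 1 := by exact_mod_cast hn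
      exact (ENat.add_le_add_iff_right ENat.one_ne_top).1 (h1.trans h2)
    have hfin : (core ι M \ {c}).Finite := Set.finite_of_encard_le_coe hcard
    have hAeq : A = core ι M \ {c} :=
      (hfin.subset hsub).eq_of_subset_of_encard_le hsub (hcard.trans hA)
    have hsing : {c} = core ι M \ A := by
      rw [hAeq, Set.sdiff_sdiff_cancel_left (Set.singleton_subset_iff.2 hc)]
    have hdef : A.Definable₁ (unaryLanguage ι) (core ι M \ A) :=
      (definable₁_core A).sdiff (definable₁_of_finite_subset (hfin.subset hsub) subset_rfl)
    exact (congrArg (A.Definable₁ (unaryLanguage ι)) hsing).mpr hdef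
  · obtain ⟨x, hxA, hx⟩ := Set.not_subset.1 hout
    obtain ⟨i, rfl⟩ := h.exists_op_eq x c hx hc
    exact op_mem_dcl hxA i

theorem swap_op [DecidableEq M] (h : EnumeratesCore ι M) {b z : M} (hb : b ∉ core ι M)
    (hz : z ∉ core ι M) (hbz : ∀ i : ι, op i z = op i b) (i : ι) (x : M) :
    Equiv.swap b z (op i x) = op i (Equiv.swap b z x) := by
  have hmem := h.op_mem_core i x
  rw [Equiv.swap_apply_of_ne_of_ne (ne_of_mem_of_not_mem hmem hb)
    (ne_of_mem_of_not_mem hmem hz)]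
  obtain rfl | hxb := eq_or_ne x b
  · rw [Equiv.swap_apply_left, hbz]
  obtain rfl | hxz := eq_or_ne x z
  · rw [Equiv.swap_apply_right, hbz]
  · rw [Equiv.swap_apply_of_ne_of_ne hxb hxz]

theorem acl_subset (h : EnumeratesCore ι M) (A : Set M) :
    acl (unaryLanguage ι) A ⊆ A ∪ core ι M := by
  classical
  intro b hb
  by_contra hbA
  obtain ⟨hbA, hbc⟩ := not_or.1 hbA
  refine notMem_acl (fun A₀ S hA₀ hA hS => ?_) hb
  -- No operation takes values outside the core, so swapping `b` with a fresh point of its fibre is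
  -- an automorphism.
  obtain ⟨z, ⟨hzc, hz⟩, hzn⟩ := ((h.infinite_fiber b hbc).sdiff (hA₀.union hS)).nonempty
  refine ⟨equivOfCommute (Equiv.swap b z) (h.swap_op hbc hzc hz), fun a ha => ?_, ?_⟩
  · exact Equiv.swap_apply_of_ne_of_ne (fun hab => hbA (hA (hab ▸ ha)))
      fun haz => hzn (Or.inl (haz ▸ ha))
  · rw [equivOfCommute_apply, Equiv.swap_apply_left]
    exact fun hzS => hzn (Or.inr hzS)

theorem dcl_eq_acl [Finite ι] (h : EnumeratesCore ι M) {n : ℕ} (hn : Nat.card ι ≤ n + 1)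
    {A : Set M} (hA : (n : ℕ∞) ≤ A.encard) :
    dcl (unaryLanguage ι) A = acl (unaryLanguage ι) A :=
  dcl_subset_acl.antisymm fun _ hb => (h.acl_subset A hb).elim
    (fun hbA => definable₁_singleton_of_mem hbA) fun hbc => h.core_subset_dcl hn hA hbc

theorem of_completeTheory [Finite ι] (h : EnumeratesCore ι M) (N : Type)
    [(unaryLanguage ι).Structure N] [N ⊨ (unaryLanguage ι).completeTheory M] :
    EnumeratesCore ι N where
  op_mem_core i x := by
    have := realize_of_completeTheory (M := M) (N := N)
      (coreFormula (opTerm i (Term.var ()))) (fun v => by simpa using h.op_mem_core i (v ()))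
      fun _ => x
    simpa using this
  exists_op_eq x y hx hy := by
    have := realize_of_completeTheory (M := M) (N := N)
      ((coreFormula (ι := ι) (Term.var (0 : Fin 2))).not.imp
        ((coreFormula (Term.var (1 : Fin 2))).imp
          (Formula.iSup fun i : ι => (opTerm i (Term.var 0)).equal (Term.var 1))))
      (fun v => by simpa using h.exists_op_eq (v 0) (v 1)) ![x, y]
    simp only [Formula.realize_imp, Formula.realize_not, realize_coreFormula, Term.realize_var,
      Formula.realize_iSup, Formula.realize_equal, realize_opTerm] at this
    exact this hx hy
  exists_notMem_core := by
    have := realize_of_completeTheory (M := M) (N := N)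
      (Formula.iExs Unit (coreFormula (ι := ι) (Term.var (Sum.inr () : Empty ⊕ Unit))).not)
      (fun v => by
        obtain ⟨x, hx⟩ := h.exists_notMem_core
        simpa using ⟨fun _ => x, hx⟩) Empty.elim
    simp only [Formula.realize_iExs, Formula.realize_not, realize_coreFormula, Term.realize_var,
      Sum.elim_inr] at this
    obtain ⟨v, hv⟩ := this
    exact ⟨v (), hv⟩
  infinite_fiber x hx hfin := by
    set W := {z | z ∉ core ι N ∧ ∀ i : ι, op i z = op i x} with hW
    have := hfin.to_subtype
    -- Infinitude is an axiom schema; the instance used says that the fibre of `none` has a point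
    -- other than the |W| listed ones.
    have := realize_of_completeTheory (M := M) (N := N)
      ((coreFormula (ι := ι) (Term.var (none : Option W))).not.imp
        (Formula.iExs Unit
          ((coreFormula (ι := ι) (Term.var (Sum.inr () : Option W ⊕ Unit))).not ⊓
            ((Formula.iInf fun i : ι =>
              (opTerm i (Term.var (Sum.inr ()))).equal (opTerm i (Term.var (Sum.inl none)))) ⊓
            Formula.iInf fun w : W =>
              ((Term.var (Sum.inr ())).equal (Term.var (Sum.inl (some w)))).not))))
      (fun v => by
        simp only [Formula.realize_imp, Formula.realize_not, realize_coreFormula,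
          Term.realize_var, Formula.realize_iExs, Formula.realize_inf, Formula.realize_iInf,
          Formula.realize_equal, realize_opTerm, Sum.elim_inl, Sum.elim_inr]
        intro hv
        obtain ⟨z, ⟨hzc, hz⟩, hzn⟩ := ((h.infinite_fiber (v none) hv).sdiff
          (Set.finite_range fun w : W => v (some w))).nonempty
        exact ⟨fun _ => z, hzc, hz, fun w hw => hzn ⟨w, hw.symm⟩⟩)
      (fun o => o.elim x Subtype.val)
    simp only [Formula.realize_imp, Formula.realize_not, realize_coreFormula,
      Term.realize_var, Formula.realize_iExs, Formula.realize_inf, Formula.realize_iInf,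
      Formula.realize_equal, realize_opTerm, Sum.elim_inl, Sum.elim_inr] at this
    obtain ⟨z, hzc, hz, hzn⟩ := this hx
    exact hzn ⟨z (), hzc, hz⟩ rfl

theorem closuresAgreeFrom [Finite ι] (h : EnumeratesCore ι M) {n : ℕ}
    (hn : Nat.card ι ≤ n + 1) :
    ClosuresAgreeFrom ((unaryLanguage ι).completeTheory M) n :=
  fun N _ hA => (h.of_completeTheory N).dcl_eq_acl hn hA

end EnumeratesCore

end Unary

/-! ### The finite values -/

/-- A set `ι` together with infinitely many names for each of its permutations. -/
def PermCover (ι : Type) : Type :=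
  ι ⊕ Equiv.Perm ι × ℕ

namespace PermCover

variable {ι : Type}

/-- Points of `ι` are fixed by all operations, names are evaluated. -/
instance : (unaryLanguage ι).Structure (PermCover ι) :=
  unaryStructure fun i => Sum.elim Sum.inl fun p => Sum.inl (p.1 i)

instance [Nonempty ι] : Nonempty (PermCover ι) :=
  inferInstanceAs (Nonempty (ι ⊕ Equiv.Perm ι × ℕ))

/-- The point of the cover given by an element of `ι`. -/
def point (i : ι) : PermCover ι :=
  Sum.inl i

/-- The names of a permutation. -/
def name (σ : Equiv.Perm ι) (k : ℕ) : PermCover ι :=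
  Sum.inr (σ, k)

theorem point_injective : Function.Injective (point : ι → PermCover ι) :=
  Sum.inl_injective

theorem point_mem_core (j : ι) : point j ∈ core ι (PermCover ι) :=
  fun _ => rfl

theorem name_notMem_core [Nonempty ι] (σ : Equiv.Perm ι) (k : ℕ) :
    name σ k ∉ core ι (PermCover ι) :=
  fun h => Sum.inl_ne_inr (h (Classical.arbitrary ι))

theorem enumeratesCore [Nonempty ι] : EnumeratesCore ι (PermCover ι) where
  op_mem_core i x := by
    rcases x with j | ⟨σ, k⟩
    · exact point_mem_core j
    · exact point_mem_core (σ i)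
  exists_op_eq x y hx hy := by
    rcases x with j | ⟨σ, k⟩
    · exact (hx (point_mem_core j)).elim
    rcases y with j | ⟨τ, l⟩
    · exact ⟨σ.symm j, congrArg point (σ.apply_symm_apply j)⟩
    · exact (name_notMem_core τ l hy).elim
  exists_notMem_core := ⟨name 1 0, name_notMem_core 1 0⟩
  infinite_fiber x hx := by
    rcases x with j | ⟨σ, k⟩
    · exact (hx (point_mem_core j)).elim
    · refine Set.infinite_of_injective_forall_mem (f := name σ) ?_
        fun l => ⟨name_notMem_core σ l, fun _ => rfl⟩
      exact fun l m hlm => congrArg Prod.snd (Sum.inr_injective hlm)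

/-- Permutations of `ι` act on its cover. -/
def autOfPerm (τ : Equiv.Perm ι) : PermCover ι ≃[unaryLanguage ι] PermCover ι :=
  -- Left multiplication on names makes evaluation equivariant: (τσ)(i) = τ(σ(i)).
  equivOfCommute (Equiv.sumCongr τ (Equiv.prodCongr (Equiv.mulLeft τ) (Equiv.refl ℕ))) <| by
    rintro i (j | ⟨σ, k⟩) <;> rfl

@[simp]
theorem autOfPerm_point (τ : Equiv.Perm ι) (i : ι) : autOfPerm τ (point i) = point (τ i) :=
  rfl

theorem aclDclDif_eq (n : ℕ) :
    aclDclDif ((unaryLanguage (Fin (n + 1))).completeTheory (PermCover (Fin (n + 1)))) = n := by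
  refine (enumeratesCore.closuresAgreeFrom (Nat.card_fin _).le).aclDclDif_eq fun m hm => ?_
  obtain _ | k := n
  · exact (Nat.not_lt_zero m hm).elim
  -- Here n = k + 1; the set consists of k of the k + 2 core points, omitting 0 and 1.
  refine not_closuresAgreeFrom (PermCover (Fin (k + 2)))
    (A := Set.range fun i : Fin k => point i.succ.succ) ?_
    (core_subset_acl _ ?_ (point_mem_core 0)) (autOfPerm (Equiv.swap 0 1)) ?_ ?_
  · have hinj : Function.Injective fun i : Fin k => point i.succ.succ :=
      point_injective.comp ((Fin.succ_injective _).comp (Fin.succ_injective _))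
    rw [← Set.image_univ, hinj.encard_image, Set.encard_univ, ENat.card_eq_coe_fintype_card, Fintype.card_fin]
    exact_mod_cast Nat.lt_succ_iff.1 hm
  · exact Set.finite_of_encard_le_coe enumeratesCore.encard_core_le
  · rintro _ ⟨i, rfl⟩
    exact congrArg point (Equiv.swap_apply_of_ne_of_ne (Fin.succ_ne_zero _)
      fun h => Fin.succ_ne_zero i (Fin.succ_injective _ h))
  · rw [autOfPerm_point, Equiv.swap_apply_left]
    exact fun h => Fin.zero_ne_one (point_injective h).symm

end PermCover

/-! ### The value ∞ -/

/-- Two isolated points and an infinite ray. -/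
def RayWithTwoPoints : Type :=
  Bool ⊕ ℕ

namespace RayWithTwoPoints

/-- The operation fixes the two points and is the successor on the ray. -/
instance : (unaryLanguage Unit).Structure RayWithTwoPoints :=
  unaryStructure fun _ => Sum.map id Nat.succ

instance : Nonempty RayWithTwoPoints :=
  inferInstanceAs (Nonempty (Bool ⊕ ℕ))

/-- The two isolated points. -/
def isolated (b : Bool) : RayWithTwoPoints :=
  Sum.inl b

/-- The points of the ray. -/
def ray (k : ℕ) : RayWithTwoPoints :=
  Sum.inr k

theorem ray_injective : Function.Injective ray :=
  Sum.inr_injective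

theorem core_subset : core Unit RayWithTwoPoints ⊆ Set.range isolated := by
  rintro (b | k) h
  · exact ⟨b, rfl⟩
  · exact (Nat.succ_ne_self k (ray_injective (h ()))).elim

/-- The automorphism exchanging the two points. -/
def exchange : RayWithTwoPoints ≃[unaryLanguage Unit] RayWithTwoPoints :=
  equivOfCommute (Equiv.sumCongr Equiv.boolNot (Equiv.refl ℕ)) <| by
    rintro i (b | k) <;> rfl

theorem aclDclDif_eq :
    aclDclDif ((unaryLanguage Unit).completeTheory RayWithTwoPoints) = ⊤ := by
  refine aclDclDif_eq_top fun m => not_closuresAgreeFrom RayWithTwoPoints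
    (A := Set.range ray) ?_ (b := isolated true)
    (core_subset_acl _ ((Set.finite_range _).subset core_subset) fun _ => rfl) exchange ?_ ?_
  · rw [(Set.infinite_range_of_injective ray_injective).encard_eq]
    exact le_top
  · rintro _ ⟨k, rfl⟩
    rfl
  · exact fun h => Bool.false_ne_true (Sum.inl_injective h)

end RayWithTwoPoints

end ModelClosure

theorem mainTheorem2 (lam : ℕ∞) :
    ∃ (L : FirstOrder.Language.{0, 0}) (T : L.Theory), T.IsComplete ∧ ModelClosure.aclDclDif T = lam := by
  induction lam using ENat.recTopCoe with
  | top =>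
    exact ⟨_, _, FirstOrder.Language.completeTheory.isComplete _ _,
      ModelClosure.RayWithTwoPoints.aclDclDif_eq⟩
  | coe n =>
    exact ⟨_, _, FirstOrder.Language.completeTheory.isComplete _ _,
      ModelClosure.PermCover.aclDclDif_eq n⟩
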